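/- For a metric space $X$ and $\varepsilon>0$ let $S_X(\varepsilon)\in\{0,1,2,\dots\}\cup\{\infty\}$ be the smallest cardinality of a cover of $X$ by connected subsets of diameter $\le\varepsilon$ (with $S_X(\varepsilon)=\infty$ if there is no finite cover of this kind). For a function $f:Y\to X$ between metric spaces, its continuity modulus is the function $\omega_f:(0,\infty)\to[0,\infty]$, $\omega_f(\delta)=\sup\big(\{d_X(f(y),f(y')):y,y'\in Y,\ d_Y(y,y')\le\delta\}\cup\{0\}\big)$. **Theorem.** Let $X$ be a nonempty compact connected metric space of diameter $\le 1$, and let $\Omega:(0,\infty)\to(0,\infty)$ be a strictly increasing function such that $(0,1]\subseteq\Omega[(0,\infty)]$; for $y\in(0,1]$ let $\Omega^{-1}(y)$ be the unique $t>0$ with $\Omega(t)=y$. If $$s:=\sum_{n=1}^\infty S_X(2^{-n})\sum_{m=n}^\infty S_X(2^{-m})\cdot\Omega^{-1}\big(\min\{1,2^{6-m}\}\big)<\infty,$$ then there exists a continuous surjective function $f:[0,s]\to X$ with $\omega_f(\delta)\le\Omega(\delta)$ for all $\delta>0$. -/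

import Mathlib

open scoped ENNReal

noncomputable section

/-- The Sierpinski function `S_X(ε)`: the smallest cardinality of a cover of `X` by connected
subsets of diameter at most `ε`, with the value `⊤` if there is no finite cover of this kind. -/
def sierpinski (X : Type*) [PseudoEMetricSpace X] (ε : ℝ) : ℕ∞ :=
  ⨅ (C : Set (Set X)) (_ : ⋃₀ C = Set.univ)
    (_ : ∀ A ∈ C, IsConnected A ∧ Metric.ediam A ≤ ENNReal.ofReal ε), C.encard

/-- The continuity modulus of `f`, with values in `[0,∞]`:
the supremum of `d (f x) (f x')` over all `x, x'` with `d x x' ≤ δ`. -/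
def contModulus {X Y : Type*} [PseudoMetricSpace X] [PseudoEMetricSpace Y]
    (f : X → Y) (δ : ℝ) : ℝ≥0∞ :=
  ⨆ (x : X) (x' : X) (_ : dist x x' ≤ δ), edist (f x) (f x')

/-- The sum over `n ≥ 1` of `S_X(2^{-n})` times the sum over `m ≥ n` of
`S_X(2^{-m}) * Ω⁻¹(min {1, 2^{6-m}})`, in `[0,∞]`.  Here `Ω⁻¹ y` is the point of `(0,∞)` that
`Ω` maps to `y`; it exists and is unique when `Ω` is injective on `(0,∞)` and attains
each value in `(0,1]` there. -/
def sierpinskiSum (X : Type*) [PseudoEMetricSpace X] (Ω : ℝ → ℝ) : ℝ≥0∞ :=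
  ∑' n : Set.Ici (1 : ℕ), (sierpinski X ((2 : ℝ) ^ (-(n : ℤ))) : ℝ≥0∞) *
    ∑' m : Set.Ici (n : ℕ), (sierpinski X ((2 : ℝ) ^ (-(m : ℤ))) : ℝ≥0∞) *
      ENNReal.ofReal (Function.invFunOn Ω (Set.Ioi 0) (min 1 ((2 : ℝ) ^ ((6 : ℤ) - (m : ℤ)))))

end

/-!
Write `N n` for `sierpinski X (2⁻ⁿ)` and `a n` for `Ω⁻¹ (min 1 (2^(6-n)))`. Already the diagonal part
`∑ N n ^ 2 * a n` of the double sum bounds the length of an interval that is long enough.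

The core is a sequence of covering chains: finite sequences of connected sets of diameter at most
`2⁻ⁿ` that cover `X`, with successive sets meeting. The chain of level `n + 1` comes with a monotone
map of its indices to those of level `n`, such that each link meets the link it is sent to, and it
has at most `(N + 1) * N` links, where `N = N (n + 1)` (`CoveringChain.exists_follows`). To build it,
take a minimal closed cover by connected sets. The members that meet a given connected link of the
old chain form a connected intersection graph, so some long walk runs along the old chain and visits
each member near each old link. Now fix for each member of the cover one visit to it, and erase the
loops between successive fixed visits; what is left has no repetition between fixed visits, still
visits all members, and inherits the monotone map (`List.IsChain.exists_sublist_length_le`).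

Given `M`, choose a point in each link of level `M`, and let the time of link `j` be
`∑ m ∈ [1, M], a m * (index of the ancestor of j at level m) / 2`, which is at most
`∑ N m ^ 2 * a m`. If two times are less than `a m` apart, then the level-`m` ancestors are equal or
adjacent, hence the points are at distance at most `4 * 2⁻ᵐ`. This gives a step function on the
interval whose modulus is controlled at the scales `m ≤ M` and whose range is `5 * 2⁻ᴹ`-dense
(`exists_step_function`). A limit of these functions along an ultrafilter is continuous and
surjective, and is controlled at all scales (`exists_continuous_surjective_of_approx`).
-/

open Filter Topology

/-! ### Loop erasure in lists -/

/-- Loop erasure: a walk, read through a labelling `π`, can be thinned out to a walk that repeats no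
label and has the same first and last label. -/
theorem List.IsChain.exists_sublist_nodup_map {α β : Type*} {r : β → β → Prop} (π : α → β)
    (l : List α) (hl : (l.map π).IsChain r) :
    ∃ l' : List α, l'.Sublist l ∧ (l'.map π).IsChain r ∧ (l'.map π).Nodup ∧
      (l'.map π).head? = (l.map π).head? ∧ (l'.map π).getLast? = (l.map π).getLast? := by
  induction l with
  | nil => exact ⟨[], by simp⟩
  | cons x l ih =>
    obtain ⟨l', hs, hc, hn, hh, hg⟩ := ih (by
      rw [List.map_cons] at hl; exact hl.of_cons)
    by_cases hx : π x ∈ l'.map π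
    · obtain ⟨y, hy, hyx⟩ := List.mem_map.1 hx
      obtain ⟨u, v, rfl⟩ := List.append_of_mem hy
      rw [List.map_append, List.map_cons] at hc hn hg
      have hv := (List.isChain_append.1 hc).2.1
      have hnv := (List.nodup_append.1 hn).2.1
      refine ⟨x :: v, ?_, ?_, ?_, ?_, ?_⟩
      · refine List.Sublist.cons_cons x (List.Sublist.trans ?_ hs)
        exact (List.sublist_cons_self y v).trans (List.sublist_append_right u _)
      · rw [List.map_cons, ← hyx]; exact hv
      · rw [List.map_cons, ← hyx]; exact hnv
      · simp
      · rw [List.getLast?_append_of_ne_nil _ (by simp)] at hg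
        rw [List.map_cons, ← hyx, hg, List.map_cons]
        cases l with
        | nil => simp at hs
        | cons z l => simp [List.getLast?_cons_cons]
    · refine ⟨x :: l', hs.cons_cons x, ?_, ?_, ?_, ?_⟩
      · rw [List.map_cons] at hl ⊢
        rw [List.isChain_cons] at hl ⊢
        exact ⟨by rw [hh]; exact hl.1, hc⟩
      · rw [List.map_cons]; exact List.nodup_cons.2 ⟨hx, hn⟩
      · simp
      · rw [List.map_cons, List.map_cons, List.getLast?_cons, List.getLast?_cons, hg]

/-- Loop erasure between visits: a walk can be thinned out so that it still visits each label in `S`,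
with at most `S.card + 1` stretches free of repetition. The end labels are kept so that stretches
can be glued. -/
theorem List.IsChain.exists_sublist_length_le {α β : Type*} [Fintype β] {r : β → β → Prop}
    (π : α → β) (S : Finset β) (l : List α) (hl : (l.map π).IsChain r)
    (hS : ∀ b ∈ S, b ∈ l.map π) :
    ∃ l' : List α, l'.Sublist l ∧ (l'.map π).IsChain r ∧ (∀ b ∈ S, b ∈ l'.map π) ∧
      l'.length ≤ (S.card + 1) * Fintype.card β ∧
      (l'.map π).head? = (l.map π).head? ∧ (l'.map π).getLast? = (l.map π).getLast? := by
  classical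
  have hlen : ∀ l' : List α, (l'.map π).Nodup → l'.length ≤ Fintype.card β := fun l' h => by
    simpa using h.length_le_card
  induction hn : S.card generalizing S l with
  | zero =>
    obtain ⟨l', hs, hc, hd, hh, hg⟩ := hl.exists_sublist_nodup_map π
    rw [Finset.card_eq_zero] at hn
    exact ⟨l', hs, hc, by simp [hn], by simpa using hlen l' hd, hh, hg⟩
  | succ n ih =>
    -- split at the first visit to `S`
    have hsplit : ∃ u x v, l = u ++ x :: v ∧ π x ∈ S ∧ ∀ y ∈ u, π y ∉ S := by
      have hex : ∃ x ∈ l, π x ∈ S := by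
        obtain ⟨b, hb⟩ := Finset.card_pos.1 (by omega : 0 < S.card)
        obtain ⟨x, hx, rfl⟩ := List.mem_map.1 (hS b hb)
        exact ⟨x, hx, hb⟩
      clear hS hl
      induction l with
      | nil => simp at hex
      | cons y l ihl =>
        by_cases hy : π y ∈ S
        · exact ⟨[], y, l, by simp, hy, by simp⟩
        · obtain ⟨u, x, v, rfl, hx, hu⟩ := ihl (by simpa [hy] using hex)
          exact ⟨y :: u, x, v, by simp, hx, by simpa [hy] using hu⟩
    obtain ⟨u, x, v, rfl, hx, hu⟩ := hsplit
    have hl' : ((u ++ [x]).map π ++ v.map π).IsChain r := by simpa using hl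
    obtain ⟨h1, h2, h3⟩ := List.isChain_append.1 hl'
    obtain ⟨p, hps, hpc, hpd, hph, hpg⟩ := h1.exists_sublist_nodup_map π
    obtain ⟨q, hqs, hqc, hqS, hql, hqh, hqg⟩ := ih (S.erase (π x)) v h2 (by
      intro b hb
      obtain ⟨hbx, hbS⟩ := Finset.mem_erase.1 hb
      have := hS b hbS
      simp only [List.map_append, List.map_cons, List.mem_append, List.mem_cons] at this
      rcases this with h | h | h
      · obtain ⟨y, hy, rfl⟩ := List.mem_map.1 h
        exact absurd hbS (hu y hy)
      · exact absurd h hbx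
      · exact h) (by rw [Finset.card_erase_of_mem hx, hn]; rfl)
    have hpx : π x ∈ p.map π := by
      refine List.mem_of_getLast? ?_
      rw [hpg]; simp
    refine ⟨p ++ q, ?_, ?_, ?_, ?_, ?_, ?_⟩
    · have := hps.append hqs
      simpa using this
    · rw [List.map_append, List.isChain_append]
      refine ⟨hpc, hqc, ?_⟩
      rw [hpg, hqh]; exact h3
    · intro b hb
      rw [List.map_append, List.mem_append]
      by_cases hbx : b = π x
      · exact Or.inl (hbx ▸ hpx)
      · exact Or.inr (hqS b (Finset.mem_erase.2 ⟨hbx, hb⟩))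
    · rw [List.length_append]
      have := hlen p hpd
      nlinarith
    · rw [List.map_append, List.head?_append, hph, hqh, ← List.head?_append, ← List.map_append]
      simp
    · rw [List.map_append, List.getLast?_append, hpg, hqg, ← List.getLast?_append,
        ← List.map_append]
      simp

/-- If of any two points one is reachable from the other, then some walk visits all points: sort the
points by reachability and interpolate. -/
theorem Relation.exists_isChain_of_total {α : Type*} [Finite α] (R : α → α → Prop)
    (hR : ∀ a b, Relation.ReflTransGen R a b ∨ Relation.ReflTransGen R b a) :
    ∃ l : List α, l.IsChain R ∧ ∀ a, a ∈ l := by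
  classical
  have key : ∀ l : List α, l.IsChain (Relation.ReflTransGen R) →
      ∃ l' : List α, l'.IsChain R ∧ l'.head? = l.head? ∧ ∀ a ∈ l, a ∈ l' := by
    intro l
    induction l with
    | nil => exact fun _ => ⟨[], by simp⟩
    | cons x l ih =>
      intro h
      obtain ⟨l', hc, hh, hm⟩ := ih h.of_cons
      cases l with
      | nil => exact ⟨[x], by simp⟩
      | cons y l =>
        have hxy : Relation.ReflTransGen R x y := by
          rw [List.isChain_cons_cons] at h; exact h.1
        clear h ih
        suffices ∃ l'' : List α, l''.IsChain R ∧ l''.head? = some x ∧ ∀ a ∈ l', a ∈ l'' by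
          obtain ⟨l'', h1, h2, h3⟩ := this
          refine ⟨l'', h1, by simpa using h2, ?_⟩
          intro a ha
          rcases List.mem_cons.1 ha with rfl | ha
          · exact List.mem_of_head? h2
          · exact h3 a (hm a ha)
        clear hm
        induction hxy using Relation.ReflTransGen.head_induction_on with
        | refl => exact ⟨l', hc, by simpa using hh, fun _ h => h⟩
        | @head a c h1 _ ih =>
          obtain ⟨m, hm1, hm2, hm3⟩ := ih
          refine ⟨a :: m, ?_, by simp, fun b hb => List.mem_cons_of_mem _ (hm3 b hb)⟩
          rw [List.isChain_cons]
          refine ⟨?_, hm1⟩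
          rw [hm2]
          intro z hz
          obtain rfl : c = z := by simpa using hz
          exact h1
  have := Fintype.ofFinite α
  have : Std.Total (Relation.ReflTransGen R) := ⟨hR⟩
  have : IsTrans α (Relation.ReflTransGen R) := ⟨fun _ _ _ => Relation.ReflTransGen.trans⟩
  obtain ⟨l', h1, -, h3⟩ := key ((Finset.univ : Finset α).toList.insertionSort
    (Relation.ReflTransGen R)) (List.pairwise_insertionSort _ _).isChain
  exact ⟨l', h1, fun a => h3 a (by simp)⟩

/-! ### Covering chains and their refinement -/

/-- In a finite closed cover, the members that meet a preconnected set `D` form a connected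
intersection graph. -/
theorem IsPreconnected.reflTransGen_of_closed_cover {X κ : Type*} [TopologicalSpace X] [Finite κ]
    {D : Set X} (hD : IsPreconnected D) {F : κ → Set X} (hF : ∀ k, IsClosed (F k))
    (hcov : ∀ x, ∃ k, x ∈ F k) {k k' : κ}
    (hk : (F k ∩ D).Nonempty) (hk' : (F k' ∩ D).Nonempty) :
    Relation.ReflTransGen (fun p q : κ => (F p ∩ F q).Nonempty ∧ (F q ∩ D).Nonempty) k k' := by
  set R : κ → κ → Prop := fun p q => (F p ∩ F q).Nonempty ∧ (F q ∩ D).Nonempty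
  by_contra hcon
  have hU : IsClosed (⋃ p ∈ {p | Relation.ReflTransGen R k p}, F p) :=
    (Set.toFinite _).isClosed_biUnion fun p _ => hF p
  have hV : IsClosed (⋃ p ∈ {p | ¬ Relation.ReflTransGen R k p}, F p) :=
    (Set.toFinite _).isClosed_biUnion fun p _ => hF p
  obtain ⟨x, hx⟩ := hk
  obtain ⟨y, hy⟩ := hk'
  obtain ⟨z, hzD, hzU, hzV⟩ := isPreconnected_closed_iff.1 hD _ _ hU hV
    (fun z _ => by
      obtain ⟨p, hp⟩ := hcov z
      by_cases h : Relation.ReflTransGen R k p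
      · exact Or.inl (Set.mem_biUnion (show p ∈ {p | Relation.ReflTransGen R k p} from h) hp)
      · exact Or.inr (Set.mem_biUnion (show p ∈ {p | ¬ Relation.ReflTransGen R k p} from h) hp))
    ⟨x, hx.2, Set.mem_biUnion (show k ∈ {p | Relation.ReflTransGen R k p} from .refl) hx.1⟩
    ⟨y, hy.2, Set.mem_biUnion (show k' ∈ {p | ¬ Relation.ReflTransGen R k p} from hcon) hy.1⟩
  obtain ⟨p, hp, hzp⟩ := Set.mem_iUnion₂.1 hzU
  obtain ⟨q, hq, hzq⟩ := Set.mem_iUnion₂.1 hzV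
  exact hq (Relation.ReflTransGen.tail hp ⟨⟨z, hzp, hzq⟩, ⟨z, hzq, hzD⟩⟩)

/-- A finite chain of connected sets that cover the space, successive ones having a common point.
Only the values of `link` at indices below `length` matter. -/
structure CoveringChain (X : Type*) [TopologicalSpace X] where
  length : ℕ
  link : ℕ → Set X
  isConnected : ∀ i < length, IsConnected (link i)
  meets : ∀ i, i + 1 < length → (link i ∩ link (i + 1)).Nonempty
  covers : ∀ x, ∃ i < length, x ∈ link i

/-- The chain `c'` runs along the chain `c`: the map `φ` of indices is monotone, and each link of `c'`
meets the link of `c` to which `φ` sends it. Links of `c` may be skipped. -/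
structure CoveringChain.Follows {X : Type*} [TopologicalSpace X] (c' c : CoveringChain X)
    (φ : ℕ → ℕ) : Prop where
  lt : ∀ j < c'.length, φ j < c.length
  mono : ∀ i j, i ≤ j → j < c'.length → φ i ≤ φ j
  meets : ∀ j < c'.length, (c'.link j ∩ c.link (φ j)).Nonempty

/-- Each covering chain is followed by a chain made of members of a given finite closed cover by
connected sets, whose length is bounded in terms of that cover only. -/
theorem CoveringChain.exists_follows {X : Type*} [TopologicalSpace X]
    (c : CoveringChain X) {κ : Type*} [Fintype κ] (F : κ → Set X)
    (hclosed : ∀ k, IsClosed (F k)) (hconn : ∀ k, IsConnected (F k))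
    (hcov : ∀ x, ∃ k, x ∈ F k) :
    ∃ (c' : CoveringChain X) (φ : ℕ → ℕ), c'.Follows c φ ∧
      c'.length ≤ (Fintype.card κ + 1) * Fintype.card κ ∧
      ∀ j < c'.length, ∃ k, c'.link j = F k := by
  classical
  -- members of the cover, tagged with the index of a link that they meet
  let α := {p : κ × Fin c.length // (F p.1 ∩ c.link p.2).Nonempty}
  let R : α → α → Prop := fun p q => (F p.1.1 ∩ F q.1.1).Nonempty ∧ p.1.2 ≤ q.1.2
  have hsame : ∀ (i : Fin c.length) (k k' : κ) (h : (F k ∩ c.link i).Nonempty)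
      (h' : (F k' ∩ c.link i).Nonempty),
      Relation.ReflTransGen R ⟨(k, i), h⟩ ⟨(k', i), h'⟩ := by
    intro i k k' h h'
    have := (c.isConnected i i.2).isPreconnected.reflTransGen_of_closed_cover hclosed hcov h h'
    induction this using Relation.ReflTransGen.head_induction_on with
    | refl => exact .refl
    | @head a b h1 _ ih =>
      exact .head (b := ⟨(b, i), h1.2⟩) ⟨h1.1, le_rfl⟩ (ih h1.2)
  have hreach : ∀ (d : ℕ) (i i' : Fin c.length) (k k' : κ) (h : (F k ∩ c.link i).Nonempty)
      (h' : (F k' ∩ c.link i').Nonempty), (i' : ℕ) = i + d →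
      Relation.ReflTransGen R ⟨(k, i), h⟩ ⟨(k', i'), h'⟩ := by
    intro d
    induction d with
    | zero =>
      intro i i' k k' h h' hd
      obtain rfl : i' = i := Fin.ext hd
      exact hsame i' k k' h h'
    | succ d ih =>
      intro i i' k k' h h' hd
      have hlt : (i : ℕ) + d + 1 < c.length := by have := i'.2; omega
      let j : Fin c.length := ⟨i + d, by omega⟩
      obtain rfl : i' = ⟨i + d + 1, hlt⟩ := Fin.ext hd
      -- an element of the fine cover through a common point of two successive links
      obtain ⟨z, hz, hz'⟩ := c.meets (i + d) hlt
      obtain ⟨m, hm⟩ := hcov z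
      have h1 : (F m ∩ c.link j).Nonempty := ⟨z, hm, hz⟩
      have h2 : (F m ∩ c.link (i + d + 1)).Nonempty := ⟨z, hm, hz'⟩
      refine (ih i j k m h h1 rfl).trans (.head (b := ⟨(m, ⟨i + d + 1, hlt⟩), h2⟩) ?_
        (hsame _ _ _ _ _))
      exact ⟨by simpa using (hconn m).nonempty, Fin.le_def.2 (Nat.le_succ _)⟩
  obtain ⟨l, hl, hall⟩ := Relation.exists_isChain_of_total R (by
    rintro ⟨⟨k, i⟩, h⟩ ⟨⟨k', i'⟩, h'⟩
    rcases le_total (i : ℕ) i' with hi | hi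
    · exact Or.inl (hreach (i' - i) i i' k k' h h' (by omega))
    · exact Or.inr (hreach (i - i') i' i k' k h' h (by omega)))
  let π : α → κ := fun p => p.1.1
  have hlπ : (l.map π).IsChain (fun p q => (F p ∩ F q).Nonempty) := by
    rw [List.isChain_map]
    exact hl.imp fun _ _ h => h.1
  have hord : l.Pairwise (fun p q => p.1.2 ≤ q.1.2) := by
    have : IsTrans α (fun p q => p.1.2 ≤ q.1.2) := ⟨fun _ _ _ => le_trans⟩
    exact List.isChain_iff_pairwise.1 (hl.imp fun _ _ h => h.2)
  obtain ⟨l', hs, hc, hvis, hlen, -, -⟩ := hlπ.exists_sublist_length_le π Finset.univ l (by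
    intro k _
    obtain ⟨x, hx⟩ := (hconn k).nonempty
    obtain ⟨i, hi, hxi⟩ := c.covers x
    exact List.mem_map.2 ⟨⟨(k, ⟨i, hi⟩), ⟨x, hx, hxi⟩⟩, hall _, rfl⟩)
  have hord' := hord.sublist hs
  rw [List.isChain_map, List.isChain_iff_getElem] at hc
  rw [List.pairwise_iff_getElem] at hord'
  refine ⟨⟨l'.length, fun j => if h : j < l'.length then F (l'[j]).1.1 else ∅, ?_, ?_, ?_⟩,
    fun j => if h : j < l'.length then (l'[j]).1.2 else 0, ⟨?_, ?_, ?_⟩, ?_, ?_⟩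
  · intro j hj
    simpa [hj] using hconn _
  · intro j hj
    have hj' : j < l'.length := by omega
    simpa [hj, hj'] using hc j hj
  · intro x
    obtain ⟨k, hk⟩ := hcov x
    obtain ⟨p, hp, rfl⟩ := List.mem_map.1 (hvis k (Finset.mem_univ k))
    obtain ⟨j, hj, rfl⟩ := List.mem_iff_getElem.1 hp
    exact ⟨j, hj, by simpa [hj] using hk⟩
  · intro j hj
    simp only [hj, dif_pos]
    exact Fin.is_lt _
  · intro i j hij hj
    have hi : i < l'.length := lt_of_le_of_lt hij hj
    have hj' : j < l'.length := hj
    simp only [hi, hj', dif_pos]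
    rcases hij.eq_or_lt with rfl | hlt
    · exact le_rfl
    · exact hord' i j hi hj hlt
  · intro j hj
    have hj' : j < l'.length := hj
    simp only [hj', dif_pos]
    exact (l'[j]).2
  · simpa using hlen
  · intro j hj
    have hj' : j < l'.length := hj
    exact ⟨(l'[j]).1.1, by simp [hj']⟩

/-! ### Limits of approximately surjective maps -/

/-- Maps `F M`, possibly discontinuous, with a common modulus at the scales `m ≤ M` and with `ε M`-dense
range have a continuous surjective limit with the same modulus. -/
theorem exists_continuous_surjective_of_approx {T X : Type*} [MetricSpace T] [CompactSpace T]
    [Nonempty T] [MetricSpace X] [CompactSpace X] {a r ε : ℕ → ℝ} (ha : ∀ m, 0 < a m)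
    (hr : Tendsto r atTop (𝓝 0)) (hε : Tendsto ε atTop (𝓝 0)) (F : ℕ → T → X)
    (hF : ∀ m M, 1 ≤ m → m ≤ M → ∀ t t', dist t t' ≤ a m → dist (F M t) (F M t') ≤ r m)
    (hdense : ∀ M, 1 ≤ M → ∀ x, ∃ t, dist x (F M t) ≤ ε M) :
    ∃ f : T → X, Continuous f ∧ Function.Surjective f ∧
      ∀ m, 1 ≤ m → ∀ t t', dist t t' ≤ a m → dist (f t) (f t') ≤ r m := by
  let U : Ultrafilter ℕ := hyperfilter ℕ
  have hU : (U : Filter ℕ) ≤ atTop := by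
    rw [← Nat.cofinite_eq_atTop]; exact hyperfilter_le_cofinite
  let f : T → X := fun t => (U.map fun M => F M t).lim
  have hf : ∀ t, Tendsto (fun M => F M t) U (𝓝 (f t)) := fun t =>
    (U.map fun M => F M t).le_nhds_lim
  have hmod : ∀ m, 1 ≤ m → ∀ t t', dist t t' ≤ a m → dist (f t) (f t') ≤ r m := by
    intro m hm t t' h
    refine le_of_tendsto ((hf t).dist (hf t')) (hU ?_)
    filter_upwards [eventually_ge_atTop m] with M hM using hF m M hm hM t t' h
  refine ⟨f, ?_, ?_, hmod⟩
  · rw [Metric.continuous_iff]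
    intro t e he
    obtain ⟨m, hm, hm1⟩ := ((hr.eventually_lt_const he).and (eventually_ge_atTop 1)).exists
    exact ⟨a m, ha m, fun t' h => (hmod m hm1 t' t h.le).trans_lt hm⟩
  · intro x
    have hch : ∀ M, ∃ t, 1 ≤ M → dist x (F M t) ≤ ε M := fun M => by
      by_cases hM : 1 ≤ M
      · obtain ⟨t, ht⟩ := hdense M hM x
        exact ⟨t, fun _ => ht⟩
      · exact ⟨Classical.arbitrary T, fun h => absurd h hM⟩
    choose τ hτ using hch
    let t : T := (U.map τ).lim
    have ht : Tendsto τ U (𝓝 t) := (U.map τ).le_nhds_lim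
    have h1 : Tendsto (fun M => F M (τ M)) U (𝓝 x) := by
      rw [tendsto_iff_dist_tendsto_zero]
      refine squeeze_zero' (.of_forall fun _ => dist_nonneg) (hU ?_) (hε.mono_left hU)
      filter_upwards [eventually_ge_atTop 1] with M hM
      rw [dist_comm]
      exact hτ M hM
    refine ⟨t, ?_⟩
    have h2 : ∀ᶠ m in atTop, dist (f t) x ≤ r m := by
      filter_upwards [eventually_ge_atTop 1] with m hm
      refine le_of_tendsto ((hf t).dist h1) ?_
      filter_upwards [hU (eventually_ge_atTop m), ht (Metric.closedBall_mem_nhds t (ha m))]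
        with M hM hτM
      refine hF m M hm hM t _ ?_
      rw [dist_comm]
      exact hτM
    exact dist_le_zero.1 (ge_of_tendsto hr h2)

/-! ### Step functions from nested chains -/

/-- The index at level `m` above the index `j` at level `m + d`, where `φ n` sends indices of level
`n + 1` to indices of level `n`. -/
def ancestor (φ : ℕ → ℕ → ℕ) (m : ℕ) : ℕ → ℕ → ℕ
  | 0, j => j
  | d + 1, j => ancestor φ m d (φ (m + d) j)

section Ancestor

variable {X : Type*} [MetricSpace X] {w : ℕ → CoveringChain X} {φ : ℕ → ℕ → ℕ}

theorem ancestor_lt (hφ : ∀ n, (w (n + 1)).Follows (w n) (φ n)) (m d j : ℕ)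
    (hj : j < (w (m + d)).length) : ancestor φ m d j < (w m).length := by
  induction d generalizing j with
  | zero => exact hj
  | succ d ih => exact ih _ ((hφ (m + d)).lt j hj)

theorem ancestor_mono (hφ : ∀ n, (w (n + 1)).Follows (w n) (φ n)) (m d i j : ℕ) (hij : i ≤ j)
    (hj : j < (w (m + d)).length) : ancestor φ m d i ≤ ancestor φ m d j := by
  induction d generalizing i j with
  | zero => exact hij
  | succ d ih => exact ih _ _ ((hφ (m + d)).mono i j hij hj) ((hφ (m + d)).lt j hj)

/-- A link is close to its ancestor: the distances along the line of descent sum to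
`2⁻ᵐ - 2⁻⁽ᵐ⁺ᵈ⁾`. -/
theorem exists_mem_link_ancestor (hφ : ∀ n, (w (n + 1)).Follows (w n) (φ n))
    (hmesh : ∀ n, ∀ j < (w n).length, ∀ x ∈ (w n).link j, ∀ y ∈ (w n).link j,
      dist x y ≤ (2⁻¹ : ℝ) ^ n) (m d j : ℕ) (hj : j < (w (m + d)).length) {x : X}
    (hx : x ∈ (w (m + d)).link j) :
    ∃ y ∈ (w m).link (ancestor φ m d j), dist x y ≤ (2⁻¹ : ℝ) ^ m := by
  suffices ∃ y ∈ (w m).link (ancestor φ m d j),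
      dist x y ≤ (2⁻¹ : ℝ) ^ m - (2⁻¹ : ℝ) ^ (m + d) by
    obtain ⟨y, hy, h⟩ := this
    exact ⟨y, hy, h.trans (sub_le_self _ (by positivity))⟩
  induction d generalizing j x with
  | zero => exact ⟨x, hx, by simp⟩
  | succ d ih =>
    obtain ⟨z, hz, hz'⟩ := (hφ (m + d)).meets j hj
    obtain ⟨y, hy, h⟩ := ih _ ((hφ (m + d)).lt j hj) hz'
    refine ⟨y, hy, ?_⟩
    have h1 := hmesh (m + d + 1) j hj x hx z hz
    have h2 := dist_triangle x z y
    have h3 : (2⁻¹ : ℝ) ^ (m + d + 1) = (2⁻¹ : ℝ) ^ (m + d) * 2⁻¹ := pow_succ _ _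
    change dist x y ≤ (2⁻¹ : ℝ) ^ m - (2⁻¹ : ℝ) ^ (m + d + 1)
    linarith

theorem dist_le_of_ancestor_le_succ (hφ : ∀ n, (w (n + 1)).Follows (w n) (φ n))
    (hmesh : ∀ n, ∀ j < (w n).length, ∀ x ∈ (w n).link j, ∀ y ∈ (w n).link j,
      dist x y ≤ (2⁻¹ : ℝ) ^ n) (m d i j : ℕ) (hij : i ≤ j) (hj : j < (w (m + d)).length)
    (h : ancestor φ m d j ≤ ancestor φ m d i + 1) {x y : X}
    (hx : x ∈ (w (m + d)).link i) (hy : y ∈ (w (m + d)).link j) :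
    dist x y ≤ 4 * (2⁻¹ : ℝ) ^ m := by
  have hi : i < (w (m + d)).length := hij.trans_lt hj
  obtain ⟨x', hx', hxx⟩ := exists_mem_link_ancestor hφ hmesh m d i hi hx
  obtain ⟨y', hy', hyy⟩ := exists_mem_link_ancestor hφ hmesh m d j hj hy
  have hi' := ancestor_lt hφ m d i hi
  have hj' := ancestor_lt hφ m d j hj
  have hle := ancestor_mono hφ m d i j hij hj
  have hmid : dist x' y' ≤ 2 * (2⁻¹ : ℝ) ^ m := by
    rcases hle.eq_or_lt with he | hlt
    · rw [← he] at hy'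
      have := hmesh m _ hi' x' hx' y' hy'
      have : (0 : ℝ) ≤ 2⁻¹ ^ m := by positivity
      linarith
    · have he : ancestor φ m d j = ancestor φ m d i + 1 := by omega
      rw [he] at hy' hj'
      obtain ⟨z, hz, hz'⟩ := (w m).meets _ hj'
      have h1 := hmesh m _ hi' x' hx' z hz
      have h2 := hmesh m _ hj' z hz' y' hy'
      have := dist_triangle x' z y'
      linarith
  have h1 := dist_triangle x x' y
  have h2 := dist_triangle x' y' y
  rw [dist_comm y y'] at hyy
  linarith

/-- At each level `M` the chains give a step function whose modulus is controlled at the scales up to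
`M` and whose range is `5 * 2⁻ᴹ`-dense. -/
theorem exists_step_function (hφ : ∀ n, (w (n + 1)).Follows (w n) (φ n))
    (hmesh : ∀ n, ∀ j < (w n).length, ∀ x ∈ (w n).link j, ∀ y ∈ (w n).link j,
      dist x y ≤ (2⁻¹ : ℝ) ^ n) {a : ℕ → ℝ} (ha : ∀ m, 0 < a m) {s : ℝ} [Nonempty X]
    (M : ℕ) (hs : ∑ m ∈ Finset.Icc 1 M, a m * ((w m).length / 2) ≤ s) :
    ∃ f : Set.Icc (0 : ℝ) s → X,
      (∀ m, 1 ≤ m → m ≤ M → ∀ t t', dist t t' ≤ a m → dist (f t) (f t') ≤ 6 * (2⁻¹ : ℝ) ^ m) ∧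
      (1 ≤ M → ∀ x, ∃ t, dist x (f t) ≤ 5 * (2⁻¹ : ℝ) ^ M) := by
  classical
  set K := (w M).length with hK
  have hKpos : 0 < K := by
    obtain ⟨i, hi, -⟩ := (w M).covers (Classical.arbitrary X)
    omega
  have hpt : ∀ j, ∃ x, j < K → x ∈ (w M).link j := fun j => by
    by_cases hj : j < K
    · exact ((w M).isConnected j hj).nonempty.imp fun _ hx _ => hx
    · exact ⟨Classical.arbitrary X, fun h => absurd h hj⟩
  choose p hp using hpt
  let ψ : ℕ → ℕ → ℕ := fun m => ancestor φ m (M - m)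
  let time : ℕ → ℝ := fun j => ∑ m ∈ Finset.Icc 1 M, a m * ((ψ m j : ℝ) / 2)
  have hψmono : ∀ m ≤ M, ∀ i j, i ≤ j → j < K → ψ m i ≤ ψ m j := fun m hm i j hij hj =>
    ancestor_mono hφ m (M - m) i j hij (by rwa [Nat.add_sub_cancel' hm])
  have htime : ∀ j < K, time j ∈ Set.Icc 0 s := by
    intro j hj
    refine ⟨Finset.sum_nonneg fun m _ => mul_nonneg (ha m).le (by positivity), le_trans ?_ hs⟩
    refine Finset.sum_le_sum fun m hm => mul_le_mul_of_nonneg_left ?_ (ha m).le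
    have hm' := (Finset.mem_Icc.1 hm).2
    have : ψ m j < (w m).length :=
      ancestor_lt hφ m (M - m) j (by rwa [Nat.add_sub_cancel' hm'])
    have : (ψ m j : ℝ) ≤ (w m).length := by exact_mod_cast this.le
    linarith
  have htime_sub : ∀ m, 1 ≤ m → m ≤ M → ∀ i j, i ≤ j → j < K →
      a m * (((ψ m j : ℝ) - ψ m i) / 2) ≤ time j - time i := by
    intro m hm hmM i j hij hj
    have : time j - time i = ∑ m ∈ Finset.Icc 1 M, a m * (((ψ m j : ℝ) - ψ m i) / 2) := by
      simp only [time, ← Finset.sum_sub_distrib]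
      exact Finset.sum_congr rfl fun _ _ => by ring
    rw [this]
    refine Finset.single_le_sum (f := fun m => a m * (((ψ m j : ℝ) - ψ m i) / 2))
      (fun n hn => mul_nonneg (ha n).le ?_) (Finset.mem_Icc.2 ⟨hm, hmM⟩)
    have : (ψ n i : ℝ) ≤ ψ n j := by
      exact_mod_cast hψmono n (Finset.mem_Icc.1 hn).2 i j hij hj
    linarith
  have hdist : ∀ m, 1 ≤ m → m ≤ M → ∀ i j, i ≤ j → j < K → time j - time i < a m →
      dist (p i) (p j) ≤ 4 * (2⁻¹ : ℝ) ^ m := by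
    intro m hm hmM i j hij hj h
    have h1 := (htime_sub m hm hmM i j hij hj).trans_lt h
    have h2 : ((ψ m j : ℝ) - ψ m i) / 2 < 1 := by
      by_contra hcon
      nlinarith [ha m, not_lt.1 hcon]
    have h3 : (ψ m j : ℝ) < ψ m i + 2 := by linarith
    have h4 : ψ m j < ψ m i + 2 := by exact_mod_cast h3
    have hMm : m + (M - m) = M := Nat.add_sub_cancel' hmM
    refine dist_le_of_ancestor_le_succ hφ hmesh m (M - m) i j hij (by rwa [hMm])
      (Nat.lt_succ_iff.1 h4) ?_ ?_
    · rw [hMm]; exact hp i (hij.trans_lt hj)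
    · rw [hMm]; exact hp j hj
  have hstep : ∀ i, i + 1 < K → dist (p i) (p (i + 1)) ≤ 2 * (2⁻¹ : ℝ) ^ M := by
    intro i hi
    obtain ⟨z, hz, hz'⟩ := (w M).meets i hi
    have h1 := hmesh M i (by omega) _ (hp i (by omega)) z hz
    have h2 := hmesh M (i + 1) hi z hz' _ (hp (i + 1) hi)
    have := dist_triangle (p i) z (p (i + 1))
    linarith
  -- the last index whose time is at most `t`
  let idx : ℝ → ℕ := fun t => Nat.findGreatest (fun j => time j ≤ t) (K - 1)
  have hidx_lt : ∀ t, idx t < K := fun t => by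
    have := Nat.findGreatest_le (P := fun j => time j ≤ t) (K - 1)
    change Nat.findGreatest _ _ < K
    omega
  have hidx_mono : ∀ t t', t ≤ t' → idx t ≤ idx t' := fun t t' h =>
    Nat.findGreatest_mono (fun _ hj => le_trans hj h) le_rfl
  have hmain : ∀ m, 1 ≤ m → m ≤ M → ∀ t t' : ℝ, t ≤ t' → t' - t ≤ a m →
      dist (p (idx t)) (p (idx t')) ≤ 6 * (2⁻¹ : ℝ) ^ m := by
    intro m hm hmM t t' htt h
    rcases (hidx_mono t t' htt).eq_or_lt with he | hlt
    · rw [he, dist_self]; positivity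
    · have hK' := hidx_lt t'
      have h1 : t < time (idx t + 1) :=
        not_le.1 (Nat.findGreatest_is_greatest (P := fun j => time j ≤ t) (n := K - 1)
          (Nat.lt_succ_self _) (by omega))
      have h2 : time (idx t') ≤ t' :=
        Nat.findGreatest_of_ne_zero (P := fun j => time j ≤ t') (n := K - 1) rfl
          (by omega)
      have h3 := hdist m hm hmM (idx t + 1) (idx t') hlt hK' (by linarith)
      have h4 := hstep (idx t) (by omega)
      have h5 : (2⁻¹ : ℝ) ^ M ≤ 2⁻¹ ^ m := pow_le_pow_of_le_one (by norm_num) (by norm_num) hmM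
      have := dist_triangle (p (idx t)) (p (idx t + 1)) (p (idx t'))
      linarith
  refine ⟨fun t => p (idx t), ?_, ?_⟩
  · intro m hm hmM t t' h
    rw [Subtype.dist_eq, Real.dist_eq] at h
    rcases le_total (t : ℝ) t' with hle | hle
    · exact hmain m hm hmM t t' hle (by rw [abs_sub_comm] at h; exact (le_abs_self _).trans h)
    · rw [dist_comm]
      exact hmain m hm hmM t' t hle ((le_abs_self _).trans h)
  · intro hM x
    obtain ⟨j, hj, hxj⟩ := (w M).covers x
    refine ⟨⟨time j, htime j hj⟩, ?_⟩
    have hle : j ≤ idx (time j) := Nat.le_findGreatest (by omega) le_rfl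
    have h1 : time (idx (time j)) ≤ time j :=
      Nat.findGreatest_spec (P := fun i => time i ≤ time j) (n := K - 1) (m := j)
        (by omega) le_rfl
    have h2 := hdist M hM le_rfl j _ hle (hidx_lt _) (by linarith [ha M])
    have h3 := hmesh M j hj x hxj _ (hp j hj)
    have := dist_triangle x (p j) (p (idx (time j)))
    change dist x (p (idx (time j))) ≤ _
    linarith

end Ancestor

/-! ### Chains from the Sierpinski function -/

/-- A minimal cover may be taken closed, as closures keep connectedness and diameter. -/
theorem exists_closed_cover_card_le_sierpinski {X : Type*} [MetricSpace X] {ε : ℝ} (hε : 0 ≤ ε)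
    (h : sierpinski X ε ≠ ⊤) :
    ∃ C : Finset (Set X), (C.card : ℕ∞) ≤ sierpinski X ε ∧ (∀ x, ∃ A ∈ C, x ∈ A) ∧
      ∀ A ∈ C, IsClosed A ∧ IsConnected A ∧ ∀ x ∈ A, ∀ y ∈ A, dist x y ≤ ε := by
  classical
  let P : Set (Set X) → Prop := fun C =>
    ⋃₀ C = Set.univ ∧ ∀ A ∈ C, IsConnected A ∧ Metric.ediam A ≤ ENNReal.ofReal ε
  have heq : sierpinski X ε = ⨅ C : {C // P C}, (C : Set (Set X)).encard := by
    rw [iInf_subtype, sierpinski]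
    exact iInf_congr fun C => by rw [iInf_and]
  have hne : Nonempty {C // P C} := by
    by_contra hcon
    rw [not_nonempty_iff] at hcon
    exact h (by rw [heq, iInf_of_empty])
  obtain ⟨⟨C, hcov, hC⟩, hmin⟩ :=
    ENat.exists_eq_iInf fun C : {C // P C} => (C : Set (Set X)).encard
  rw [← heq] at hmin
  have hfin : C.Finite := Set.encard_ne_top_iff.1 (by rw [hmin]; exact h)
  refine ⟨hfin.toFinset.image closure, ?_, ?_, ?_⟩
  · rw [← hmin]
    change _ ≤ C.encard
    rw [hfin.encard_eq_coe_toFinset_card]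
    exact_mod_cast Finset.card_image_le
  · intro x
    obtain ⟨A, hA, hx⟩ := Set.mem_sUnion.1 (hcov ▸ Set.mem_univ x)
    exact ⟨closure A, Finset.mem_image_of_mem _ (hfin.mem_toFinset.2 hA), subset_closure hx⟩
  · intro B hB
    obtain ⟨A, hA, rfl⟩ := Finset.mem_image.1 hB
    obtain ⟨hconn, hd⟩ := hC A (hfin.mem_toFinset.1 hA)
    refine ⟨isClosed_closure, hconn.closure, fun x hx y hy => ?_⟩
    rw [← ENNReal.ofReal_le_ofReal_iff hε, ← edist_dist]
    exact (Metric.edist_le_ediam_of_mem hx hy).trans ((Metric.ediam_closure A).trans_le hd)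

/-- The chain of level `0` has the whole space as its only link. -/
theorem exists_refining_chains {X : Type*} [MetricSpace X] [CompactSpace X] [ConnectedSpace X]
    (hdiam : Metric.diam (Set.univ : Set X) ≤ 1)
    (hfin : ∀ n : ℕ, sierpinski X ((2⁻¹ : ℝ) ^ (n + 1)) ≠ ⊤) :
    ∃ (w : ℕ → CoveringChain X) (φ : ℕ → ℕ → ℕ),
      (∀ n, (w (n + 1)).Follows (w n) (φ n)) ∧
      (∀ n, ∀ j < (w n).length, ∀ x ∈ (w n).link j, ∀ y ∈ (w n).link j,
        dist x y ≤ (2⁻¹ : ℝ) ^ n) ∧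
      ∀ n, ((w (n + 1)).length : ℕ∞) ≤ 2 * sierpinski X ((2⁻¹ : ℝ) ^ (n + 1)) ^ 2 := by
  have hstep : ∀ (n : ℕ) (c : CoveringChain X), ∃ (c' : CoveringChain X) (φ : ℕ → ℕ),
      c'.Follows c φ ∧ (∀ j < c'.length, ∀ x ∈ c'.link j, ∀ y ∈ c'.link j,
        dist x y ≤ (2⁻¹ : ℝ) ^ (n + 1)) ∧
      (c'.length : ℕ∞) ≤ 2 * sierpinski X ((2⁻¹ : ℝ) ^ (n + 1)) ^ 2 := by
    intro n c
    obtain ⟨C, hcard, hcov, hC⟩ :=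
      exists_closed_cover_card_le_sierpinski (by positivity) (hfin n)
    obtain ⟨c', φ, hφ, hlen, hlink⟩ := c.exists_follows (fun A : C => (A : Set X))
      (fun A => (hC A A.2).1) (fun A => (hC A A.2).2.1)
      (fun x => by obtain ⟨A, hA, hx⟩ := hcov x; exact ⟨⟨A, hA⟩, hx⟩)
    refine ⟨c', φ, hφ, fun j hj => ?_, ?_⟩
    · obtain ⟨A, hA⟩ := hlink j hj
      rw [hA]
      exact (hC A A.2).2.2
    · rw [Fintype.card_coe] at hlen
      have hpos : 1 ≤ C.card := by
        obtain ⟨A, hA, -⟩ := hcov (Classical.arbitrary X)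
        exact Finset.card_pos.2 ⟨A, hA⟩
      have h2 : c'.length ≤ 2 * C.card ^ 2 := by nlinarith
      calc (c'.length : ℕ∞) ≤ 2 * (C.card : ℕ∞) ^ 2 := by exact_mod_cast h2
        _ ≤ _ := by gcongr
  choose next ψ h1 h2 h3 using hstep
  let c₀ : CoveringChain X :=
    { length := 1
      link := fun _ => Set.univ
      isConnected := fun _ _ => isConnected_univ
      meets := fun i hi => by omega
      covers := fun x => ⟨0, Nat.one_pos, Set.mem_univ x⟩ }
  let w : ℕ → CoveringChain X := fun n => Nat.rec c₀ next n
  refine ⟨w, fun n => ψ n (w n), fun n => h1 n (w n), ?_, fun n => h3 n (w n)⟩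
  rintro (_ | n) j hj x hx y hy
  · rw [pow_zero]
    exact (Metric.dist_le_diam_of_mem isCompact_univ.isBounded (Set.mem_univ x)
      (Set.mem_univ y)).trans hdiam
  · exact h2 n (w n) j hj x hx y hy

/-! ### The parametrization -/

theorem theorem1p1 (X : Type*) [MetricSpace X] [CompactSpace X] [ConnectedSpace X]
    (hdiam : Metric.diam (Set.univ : Set X) ≤ 1)
    (Ω : ℝ → ℝ) (hpos : Set.MapsTo Ω (Set.Ioi 0) (Set.Ioi 0))
    (hmono : StrictMonoOn Ω (Set.Ioi 0))
    (hrange : Set.Ioc (0 : ℝ) 1 ⊆ Ω '' Set.Ioi 0)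
    (hs : sierpinskiSum X Ω < ⊤) :
    ∃ f : Set.Icc (0 : ℝ) (sierpinskiSum X Ω).toReal → X,
      Continuous f ∧ Function.Surjective f ∧
        ∀ δ : ℝ, 0 < δ → contModulus f δ ≤ ENNReal.ofReal (Ω δ) := by
  let a : ℕ → ℝ := fun m =>
    Function.invFunOn Ω (Set.Ioi 0) (min 1 ((2 : ℝ) ^ ((6 : ℤ) - (m : ℤ))))
  have hmem : ∀ m : ℕ, min 1 ((2 : ℝ) ^ ((6 : ℤ) - (m : ℤ))) ∈ Ω '' Set.Ioi 0 := fun m =>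
    hrange ⟨lt_min one_pos (by positivity), min_le_left _ _⟩
  have ha : ∀ m, 0 < a m := fun m => Function.invFunOn_mem (hmem m)
  have hΩa : ∀ m, Ω (a m) = min 1 ((2 : ℝ) ^ ((6 : ℤ) - (m : ℤ))) := fun m =>
    Function.invFunOn_eq (hmem m)
  let S : ℕ → ℕ∞ := fun m => sierpinski X ((2⁻¹ : ℝ) ^ m)
  have hpow : ∀ m : ℕ, (2 : ℝ) ^ (-(m : ℤ)) = 2⁻¹ ^ m := fun m => by simp
  -- keep the diagonal terms `m = n` of the double sum
  have hdiag : ∑' n : Set.Ici (1 : ℕ), (S n : ℝ≥0∞) * (S n * ENNReal.ofReal (a n)) ≤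
      sierpinskiSum X Ω := by
    unfold sierpinskiSum
    refine ENNReal.tsum_le_tsum fun n => ?_
    simp only [hpow]
    gcongr
    exact ENNReal.le_tsum (f := fun m : Set.Ici (n : ℕ) => (S m : ℝ≥0∞) *
      ENNReal.ofReal (a m)) ⟨n, Set.mem_Ici.2 le_rfl⟩
  have hpartial : ∀ M : ℕ, ∑ m ∈ Finset.Icc 1 M, (S m : ℝ≥0∞) * (S m * ENNReal.ofReal (a m)) ≤
      sierpinskiSum X Ω := by
    intro M
    refine le_trans ?_ hdiag
    rw [tsum_subtype (Set.Ici 1) fun n : ℕ => (S n : ℝ≥0∞) * (S n * ENNReal.ofReal (a n))]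
    refine le_trans (le_of_eq ?_) (ENNReal.sum_le_tsum (Finset.Icc 1 M))
    refine Finset.sum_congr rfl fun m hm => ?_
    rw [Set.indicator_of_mem (Set.mem_Ici.2 (Finset.mem_Icc.1 hm).1)]
  have hfin : ∀ n : ℕ, S (n + 1) ≠ ⊤ := by
    intro n htop
    have h1 : ∑ m ∈ Finset.Icc 1 (n + 1), (S m : ℝ≥0∞) * (S m * ENNReal.ofReal (a m)) < ⊤ :=
      (hpartial (n + 1)).trans_lt hs
    have h2 := (ENNReal.sum_lt_top.1 h1) (n + 1) (Finset.mem_Icc.2 ⟨by omega, le_rfl⟩)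
    rw [htop] at h2
    have h3 : ENNReal.ofReal (a (n + 1)) ≠ 0 := by simpa using ha (n + 1)
    simp [ENNReal.top_mul h3] at h2
  obtain ⟨w, φ, hφ, hmesh, hlen⟩ := exists_refining_chains hdiam hfin
  have hsum : ∀ M, ∑ m ∈ Finset.Icc 1 M, a m * (((w m).length : ℝ) / 2) ≤
      (sierpinskiSum X Ω).toReal := by
    intro M
    rw [← ENNReal.ofReal_le_iff_le_toReal hs.ne,
      ENNReal.ofReal_sum_of_nonneg fun m _ => mul_nonneg (ha m).le (by positivity)]
    refine (Finset.sum_le_sum fun m hm => ?_).trans (hpartial M)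
    obtain ⟨n, rfl⟩ : ∃ n, m = n + 1 := ⟨m - 1, by have := (Finset.mem_Icc.1 hm).1; omega⟩
    obtain ⟨N, hN⟩ := ENat.ne_top_iff_exists.1 (hfin n)
    have h := hlen n
    change _ ≤ 2 * S (n + 1) ^ 2 at h
    rw [← hN] at h ⊢
    have h' : (w (n + 1)).length ≤ 2 * N ^ 2 := by exact_mod_cast h
    have h'' : ((w (n + 1)).length : ℝ) ≤ 2 * (N : ℝ) ^ 2 := by exact_mod_cast h'
    calc ENNReal.ofReal (a (n + 1) * (((w (n + 1)).length : ℝ) / 2))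
        ≤ ENNReal.ofReal ((N : ℝ) * (N * a (n + 1))) :=
          ENNReal.ofReal_le_ofReal (by nlinarith [ha (n + 1)])
      _ = _ := by
          rw [ENNReal.ofReal_mul (by positivity), ENNReal.ofReal_mul (by positivity)]
          simp
  choose F hF hdense using fun M => exists_step_function hφ hmesh ha M (hsum M)
  have hlim : ∀ C : ℝ, Tendsto (fun m : ℕ => C * (2⁻¹ : ℝ) ^ m) atTop (𝓝 0) := fun C => by
    simpa using (tendsto_pow_atTop_nhds_zero_of_lt_one (r := (2⁻¹ : ℝ)) (by norm_num)
      (by norm_num)).const_mul C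
  have : Nonempty (Set.Icc (0 : ℝ) (sierpinskiSum X Ω).toReal) :=
    ⟨⟨0, le_rfl, ENNReal.toReal_nonneg⟩⟩
  obtain ⟨f, hcont, hsurj, hmod⟩ := exists_continuous_surjective_of_approx ha (hlim 6) (hlim 5) F
    (fun m M hm hmM => hF M m hm hmM) hdense
  refine ⟨f, hcont, hsurj, fun δ hδ => ?_⟩
  refine iSup_le fun x => iSup_le fun x' => iSup_le fun hx => ?_
  rw [edist_dist]
  refine ENNReal.ofReal_le_ofReal ?_
  rcases le_or_gt 1 (Ω δ) with h1 | h1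
  · exact ((Metric.dist_le_diam_of_mem isCompact_univ.isBounded (Set.mem_univ _)
      (Set.mem_univ _)).trans hdiam).trans h1
  · obtain ⟨n, hn, hn'⟩ := exists_nat_pow_near_of_lt_one (hpos hδ) h1.le
      (by norm_num : (0 : ℝ) < 2⁻¹) (by norm_num)
    have hΩn : Ω (a (n + 6)) = 2⁻¹ ^ n := by
      have he : (6 : ℤ) - ((n + 6 : ℕ) : ℤ) = -(n : ℤ) := by push_cast; ring
      rw [hΩa, he, hpow]
      exact min_eq_right (pow_le_one₀ (by norm_num) (by norm_num))
    -- `2⁻ⁿ⁻¹ < Ω δ ≤ 2⁻ⁿ = Ω (a (n + 6))`, and the modulus at scale `n + 6` is `6 * 2⁻⁶ * 2⁻ⁿ`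
    have hδa : δ ≤ a (n + 6) := (hmono.le_iff_le hδ (ha _)).1 (by rw [hΩn]; exact hn')
    have h2 := hmod (n + 6) (by omega) x x' (hx.trans hδa)
    have h3 : (0 : ℝ) < 2⁻¹ ^ n := by positivity
    rw [pow_succ] at hn
    rw [pow_add] at h2
    norm_num at h2 hn h3 ⊢
    linarith
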